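/- A coarse structure on a set $X$ is a nonempty family $\mathcal{E}$ of subsets of $X\times X$ containing the diagonal $\Delta_X$ that is closed under composition, under inversion and under passing to subsets that contain $\Delta_X$, and such that every pair $(x,y)\in X\times X$ lies in some $\varepsilon\in\mathcal{E}$; the pair $(X,\mathcal{E})$ is called a ballean. Write $\varepsilon[x]=\{y:(x,y)\in\varepsilon\}$ and $\varepsilon[A]=\bigcup_{a\in A}\varepsilon[a]$. A set is bounded if it is contained in some $\varepsilon[x]$ with $\varepsilon\in\mathcal E$. A map $f:(X,\mathcal E)\to(X',\mathcal E')$ is coarse if for every $\varepsilon\in\mathcal{E}$ there is $\varepsilon'\in\mathcal{E}'$ with $f(\varepsilon[x])\subseteq\varepsilon'[f(x)]$ for all $x$. A subset $Y$ of $X$, with the restrictions of the members of $\mathcal{E}$ to $Y\times Y$, is a subballean. $(X,\mathcal{E})$ is metrizable if there is a metric $d$ on $X$ such that the sets $\{(x,y):d(x,y)<r\}$, $r>0$, form a base of $\mathcal{E}$ (they belong to $\mathcal E$, and each member of $\mathcal{E}$ is contained in one of them). A set $U\subseteq X$ is an asymptotic neighbourhood of $A\subseteq X$ if $\varepsilon[A]\setminus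 U$ is bounded for every $\varepsilon\in\mathcal E$. $(X,\mathcal{E})$ is normal if any two sets $A,B\subseteq X$ such that $\varepsilon[A]\cap\varepsilon[B]$ is bounded for every $\varepsilon\in\mathcal{E}$ have disjoint asymptotic neighbourhoods. A vector ideal on a real vector space $\mathcal{V}$ is a family $\mathcal{I}$ of subsets of $\mathcal{V}$ with $\bigcup\mathcal{I}=\mathcal{V}$ that is closed under finite unions and subsets and contains $U+U$ and $[-\lambda,\lambda]U$ for all $U\in\mathcal{I}$ and $\lambda>0$. The vector ballean $(\mathcal{V},\mathcal{I})$ is $\mathcal{V}$ with the coarse structure consisting of the sets $\varepsilon\supseteq\Delta_{\mathcal V}$ that are contained in $\{(x,y):x-y\in U\}$ for some $U\in\mathcal{I}$. Let $\mathbb{V}(X)$ be the real vector space with basis $X$. A free vector ideal over $(X,\mathcal{E})$ is a vector ideal $\mathcal{I}$ on $\mathbb{V}(X)$ such that $(X,\mathcal{E})$ is a subballean of $(\mathbb{V}(X),\mathcal{I})$ and every coarse map from $(X,\mathcal{E})$ to a vector ballean $(\mathcal{V}',\mathcal{I}')$ extends to a unique coarse linear map $(\mathbb{V}(X),\mathcal{I})\to(\mathcal{V}',\mathcal{I}')$.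 **Theorem 3.** For every ballean $(X,\mathcal{E})$ there is exactly one free vector ideal $\mathcal I_{(X,\mathcal{E})}$ over $(X,\mathcal{E})$, and the free vector ballean $\mathbb{V}(X,\mathcal{E})=(\mathbb{V}(X),\mathcal{I}_{(X,\mathcal{E})})$ is normal if and only if it is metrizable. Moreover, $\mathbb{V}(X,\mathcal{E})$ is metrizable if and only if $(X,\mathcal{E})$ is metrizable. -/

import Mathlib

open scoped Pointwise

universe u v

/-- A coarse structure on `X`, given by its family of entourages. The field `diag_mem` follows
from the other ones unless `X` is empty, where it says that the family is nonempty. -/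
@[ext]
structure CoarseStructure (X : Type u) where
  sets : Set (Set (X × X))
  diag_mem : Set.diagonal X ∈ sets
  diag_subset : ∀ ε ∈ sets, Set.diagonal X ⊆ ε
  comp_mem : ∀ ε ∈ sets, ∀ δ ∈ sets,
    {p : X × X | ∃ z, (p.1, z) ∈ ε ∧ (z, p.2) ∈ δ} ∈ sets
  inv_mem : ∀ ε ∈ sets, {p : X × X | (p.2, p.1) ∈ ε} ∈ sets
  mem_of_subset : ∀ ε ∈ sets, ∀ ε' : Set (X × X),
    Set.diagonal X ⊆ ε' → ε' ⊆ ε → ε' ∈ sets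
  connected : ∀ x y : X, ∃ ε ∈ sets, (x, y) ∈ ε

/-- The ball `ε[x]`. -/
def relBall {X : Type u} (ε : Set (X × X)) (x : X) : Set X := {y | (x, y) ∈ ε}

/-- The ball `ε[A]` around a set. -/
def relBallSet {X : Type u} (ε : Set (X × X)) (A : Set X) : Set X := ⋃ a ∈ A, relBall ε a

namespace CoarseStructure

variable {X : Type u} {Y : Type v}

/-- Bounded subsets. -/
def IsBounded (E : CoarseStructure X) (B : Set X) : Prop :=
  ∃ x : X, ∃ ε ∈ E.sets, B ⊆ relBall ε x

/-- Coarse (macro-uniform) mappings. -/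
def IsCoarseMap (E : CoarseStructure X) (F : CoarseStructure Y) (f : X → Y) : Prop :=
  ∀ ε ∈ E.sets, ∃ ε' ∈ F.sets, ∀ x, f '' relBall ε x ⊆ relBall ε' (f x)

/-- `X`, identified with a subset of `Y` by the injection `ι`, is a subballean of `Y`: its
entourages are exactly the restrictions of the entourages of `Y`. -/
def IsSubballean (E : CoarseStructure X) (F : CoarseStructure Y) (ι : X → Y) : Prop :=
  Function.Injective ι ∧
    ∀ ε : Set (X × X), ε ∈ E.sets ↔ ∃ ε' ∈ F.sets, ε = {p | (ι p.1, ι p.2) ∈ ε'}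

/-- The coarse structure of a metric `d`, with base `{(x, y) | d x y < r}`, `r > 0`. -/
def ofMetric (m : MetricSpace X) : CoarseStructure X where
  sets := {ε | Set.diagonal X ⊆ ε ∧ ∃ r : ℝ, 0 < r ∧ ε ⊆ {p | dist p.1 p.2 < r}}
  diag_mem := by
    refine ⟨subset_rfl, 1, one_pos, ?_⟩
    rintro ⟨x, y⟩ h
    obtain rfl : x = y := h
    simp
  diag_subset := fun _ h => h.1
  comp_mem := by
    rintro ε ⟨hε, r, hr, hr'⟩ δ ⟨hδ, s, hs, hs'⟩
    refine ⟨?_, r + s, add_pos hr hs, ?_⟩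
    · rintro ⟨x, y⟩ h
      obtain rfl : x = y := h
      exact ⟨x, hε rfl, hδ rfl⟩
    · rintro ⟨x, y⟩ ⟨z, h1, h2⟩
      have h1 : dist x z < r := hr' h1
      have h2 : dist z y < s := hs' h2
      exact lt_of_le_of_lt (dist_triangle x z y) (add_lt_add h1 h2)
  inv_mem := by
    rintro ε ⟨hε, r, hr, hr'⟩
    refine ⟨?_, r, hr, ?_⟩
    · rintro ⟨x, y⟩ h
      obtain rfl : x = y := h
      exact hε rfl
    · rintro ⟨x, y⟩ h
      have h : dist y x < r := hr' h
      exact (dist_comm x y).trans_lt h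
  mem_of_subset := by
    rintro ε ⟨_, r, hr, hr'⟩ ε' h1 h2
    exact ⟨h1, r, hr, h2.trans hr'⟩
  connected := by
    intro x y
    have h : (0 : ℝ) < dist x y + 1 := add_pos_of_nonneg_of_pos dist_nonneg one_pos
    refine ⟨{p | dist p.1 p.2 < dist x y + 1}, ⟨?_, _, h, subset_rfl⟩, lt_add_one (dist x y)⟩
    rintro ⟨a, b⟩ hab
    obtain rfl : a = b := hab
    simpa using h

def IsMetrizable (E : CoarseStructure X) : Prop :=
  ∃ m : MetricSpace X, E = ofMetric m

/-- `U` is an asymptotic neighbourhood of `A`. -/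
def IsAsymptoticNhd (E : CoarseStructure X) (A U : Set X) : Prop :=
  ∀ ε ∈ E.sets, E.IsBounded (relBallSet ε A \ U)

def AsymptoticallyDisjoint (E : CoarseStructure X) (A B : Set X) : Prop :=
  ∀ ε ∈ E.sets, E.IsBounded (relBallSet ε A ∩ relBallSet ε B)

def AsymptoticallySeparated (E : CoarseStructure X) (A B : Set X) : Prop :=
  ∃ U V : Set X, E.IsAsymptoticNhd A U ∧ E.IsAsymptoticNhd B V ∧ Disjoint U V

def IsNormal (E : CoarseStructure X) : Prop :=
  ∀ A B : Set X, E.AsymptoticallyDisjoint A B → E.AsymptoticallySeparated A B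

end CoarseStructure

/-- A vector ideal on a real vector space. -/
@[ext]
structure VectorIdeal (V : Type u) [AddCommGroup V] [Module ℝ V] where
  sets : Set (Set V)
  union_mem : ∀ U ∈ sets, ∀ U' ∈ sets, U ∪ U' ∈ sets
  mem_of_subset : ∀ U ∈ sets, ∀ W : Set V, W ⊆ U → W ∈ sets
  add_mem : ∀ U ∈ sets, U + U ∈ sets
  smul_mem : ∀ U ∈ sets, ∀ c : ℝ, 0 < c → Set.Icc (-c) c • U ∈ sets
  sUnion_eq : ⋃₀ sets = Set.univ

namespace VectorIdeal

variable {V : Type u} [AddCommGroup V] [Module ℝ V]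

theorem singleton_mem (I : VectorIdeal V) (x : V) : {x} ∈ I.sets := by
  have hx : x ∈ ⋃₀ I.sets := I.sUnion_eq ▸ Set.mem_univ x
  obtain ⟨U, hU, hxU⟩ := hx
  exact I.mem_of_subset U hU _ (Set.singleton_subset_iff.2 hxU)

/-- The ballean of a vector ideal: the coarse structure with base
`{(x, y) | x - y ∈ U}`, `U` in the ideal. -/
def toCoarse (I : VectorIdeal V) : CoarseStructure V where
  sets := {ε | Set.diagonal V ⊆ ε ∧ ∃ U ∈ I.sets, ε ⊆ {p | p.1 - p.2 ∈ U}}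
  diag_mem := by
    refine ⟨subset_rfl, {0}, I.singleton_mem 0, ?_⟩
    rintro ⟨x, y⟩ h
    obtain rfl : x = y := h
    simp
  diag_subset := fun _ h => h.1
  comp_mem := by
    rintro ε ⟨hε, U, hU, hU'⟩ δ ⟨hδ, W, hW, hW'⟩
    refine ⟨?_, _, I.add_mem _ (I.union_mem U hU W hW), ?_⟩
    · rintro ⟨x, y⟩ h
      obtain rfl : x = y := h
      exact ⟨x, hε rfl, hδ rfl⟩
    · rintro ⟨x, y⟩ ⟨z, h1, h2⟩
      exact ⟨x - z, Or.inl (hU' h1), z - y, Or.inr (hW' h2), sub_add_sub_cancel x z y⟩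
  inv_mem := by
    rintro ε ⟨hε, U, hU, hU'⟩
    refine ⟨?_, _, I.smul_mem U hU 1 one_pos, ?_⟩
    · rintro ⟨x, y⟩ h
      obtain rfl : x = y := h
      exact hε rfl
    · rintro ⟨x, y⟩ h
      refine ⟨-1, by simp, y - x, hU' h, ?_⟩
      simp
  mem_of_subset := by
    rintro ε ⟨_, U, hU, hU'⟩ ε' h1 h2
    exact ⟨h1, U, hU, h2.trans hU'⟩
  connected := by
    intro x y
    refine ⟨{p | p.1 - p.2 ∈ ({x - y} ∪ {0} : Set V)}, ⟨?_, _,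
      I.union_mem _ (I.singleton_mem _) _ (I.singleton_mem _), subset_rfl⟩, Or.inl rfl⟩
    rintro ⟨a, b⟩ h
    obtain rfl : a = b := h
    exact Or.inr (sub_self a)

end VectorIdeal

/-- `I` is a free vector ideal over the ballean `(X, E)`. The vector space with basis `X` is
`X →₀ ℝ`, and `x : X` is identified with the basis vector `Finsupp.single x 1`. -/
structure IsFreeVectorIdeal {X : Type u} (E : CoarseStructure X)
    (I : VectorIdeal (X →₀ ℝ)) : Prop where
  subballean : E.IsSubballean I.toCoarse (fun x => Finsupp.single x (1 : ℝ))
  lift : ∀ (W : Type u) [AddCommGroup W] [Module ℝ W] (J : VectorIdeal W) (f : X → W),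
    E.IsCoarseMap J.toCoarse f →
      ∃! h : (X →₀ ℝ) →ₗ[ℝ] W,
        I.toCoarse.IsCoarseMap J.toCoarse h ∧ ∀ x, h (Finsupp.single x 1) = f x

open Set

/-! The free ideal is the least vector ideal containing every `diffSet ε`. Preimages of vector
ideals under linear maps are vector ideals, so minimality gives the lifting property; two free
ideals agree because the identity is coarse both ways.

The hard point is that `X` keeps its coarse structure. In an increasing chain of sets that grows by
at least the `ε`-neighbourhood at each step, at most one member separates a given pair of `ε`. The
number of members whose functional is nonzero at `v` is subadditive and does not grow under scaling,
so sets with bounded counts form a vector ideal (`crossingIdeal`), which contains the free one.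
Testing `x - y` on the balls around `x` bounds the distance from `x` to `y`
(`CrossingBound.mem_iterBall`).

Both equivalences pass through countable bases. A countable base of `E` yields a sequence of
symmetric sets exhausting the free ideal, hence a metric (`isMetrizable_of_seq`). Conversely,
disjoint asymptotic neighbourhoods of the ray `ℕ x₀` and of the hyperplane of coordinate sum `0` cut
out countably many bounded sets, cofinal among the bounded subsets of the hyperplane
(`hasCountableBase_of_isNormal`). -/

theorem eq_preimage_diagonal_union_image {X : Type u} {Y : Type v} {ι : X → Y}
    (hι : Function.Injective ι) {ε : Set (X × X)} (hε : diagonal X ⊆ ε) :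
    ε = {p | (ι p.1, ι p.2) ∈ diagonal Y ∪ Prod.map ι ι '' ε} := by
  ext ⟨x, y⟩
  constructor
  · exact fun h => Or.inr ⟨_, h, rfl⟩
  · rintro (h | h)
    · exact hε (hι h)
    · exact (hι.prodMap hι).mem_set_image.1 h

/-! ### Countable bases, metrizability and normality of coarse structures -/

namespace CoarseStructure

variable {X : Type u} {Y : Type v}

theorem union_mem (E : CoarseStructure X) {ε δ : Set (X × X)} (hε : ε ∈ E.sets)
    (hδ : δ ∈ E.sets) : ε ∪ δ ∈ E.sets := by
  refine E.mem_of_subset _ (E.comp_mem ε hε δ hδ) _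
    ((E.diag_subset ε hε).trans subset_union_left) ?_
  rintro ⟨x, y⟩ (h | h)
  · exact ⟨y, h, E.diag_subset δ hδ rfl⟩
  · exact ⟨x, E.diag_subset ε hε rfl, h⟩

/-- The coarse structure has a countable base. -/
def HasCountableBase (E : CoarseStructure X) : Prop :=
  ∃ ε : ℕ → Set (X × X), (∀ n, ε n ∈ E.sets) ∧ ∀ δ ∈ E.sets, ∃ n, δ ⊆ ε n

theorem IsMetrizable.hasCountableBase {E : CoarseStructure X} (h : E.IsMetrizable) :
    E.HasCountableBase := by
  obtain ⟨m, rfl⟩ := h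
  refine ⟨fun n => {p | dist p.1 p.2 < (n : ℝ) + 1},
    fun n => ⟨?_, n + 1, by positivity, subset_rfl⟩, ?_⟩
  · rintro ⟨x, y⟩ h
    obtain rfl : x = y := h
    simp only [mem_ofPred_eq, dist_self]
    positivity
  · rintro δ ⟨-, r, -, hδ⟩
    obtain ⟨n, hn⟩ := exists_nat_gt r
    refine ⟨n, fun p hp => ?_⟩
    have : dist p.1 p.2 < r := hδ hp
    show dist p.1 p.2 < (n : ℝ) + 1
    linarith

theorem IsMetrizable.of_isSubballean {E : CoarseStructure X} {F : CoarseStructure Y} {ι : X → Y}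
    (hι : E.IsSubballean F ι) (h : F.IsMetrizable) : E.IsMetrizable := by
  obtain ⟨m, rfl⟩ := h
  refine ⟨MetricSpace.induced ι hι.1 m, CoarseStructure.ext (Set.ext fun ε => ?_)⟩
  rw [hι.2]
  constructor
  · rintro ⟨ε', ⟨hd, r, hr, hsub⟩, rfl⟩
    refine ⟨?_, r, hr, fun p hp => hsub hp⟩
    rintro ⟨x, y⟩ h
    obtain rfl : x = y := h
    exact hd rfl
  · rintro ⟨hd, r, hr, hsub⟩
    refine ⟨diagonal Y ∪ Prod.map ι ι '' ε, ⟨subset_union_left, r, hr, ?_⟩, ?_⟩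
    · rintro ⟨a, b⟩ (h | ⟨⟨x, y⟩, hxy, h⟩)
      · obtain rfl : a = b := h
        simpa using hr
      · obtain ⟨rfl, rfl⟩ := Prod.mk.inj h
        exact hsub hxy
    · exact eq_preimage_diagonal_union_image hι.1 hd

theorem isNormal_of_isMetrizable {E : CoarseStructure X} (h : E.IsMetrizable) : E.IsNormal := by
  obtain ⟨m, rfl⟩ := h
  -- The neighbourhood consists of the points strictly closer to some point of `A` than to all of
  -- `B`; a point within `r` of `A` that it misses is also within `r` of `B`.
  have key : ∀ A B : Set X, (ofMetric m).AsymptoticallyDisjoint A B →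
      (ofMetric m).IsAsymptoticNhd A {x | ∃ a ∈ A, ∀ b ∈ B, dist a x < dist b x} := by
    rintro A B hAB ε ⟨-, r, hr, hε⟩
    obtain ⟨x, δ, hδ, hsub⟩ := hAB {p | dist p.1 p.2 < r} ⟨fun p hp => by
      have hp : p.1 = p.2 := hp
      simpa [hp] using hr, r, hr, subset_rfl⟩
    refine ⟨x, δ, hδ, Subset.trans ?_ hsub⟩
    rintro y ⟨hy, hyU⟩
    simp only [relBallSet, relBall, mem_iUnion, mem_ofPred_eq, exists_prop] at hy hyU
    push Not at hyU
    obtain ⟨a, ha, hay⟩ := hy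
    have hay : dist a y < r := hε hay
    obtain ⟨b, hb, hby⟩ := hyU a ha
    simp only [relBallSet, relBall, mem_inter_iff, mem_iUnion, mem_ofPred_eq, exists_prop]
    exact ⟨⟨a, ha, hay⟩, b, hb, hby.trans_lt hay⟩
  intro A B hAB
  refine ⟨_, _, key A B hAB, key B A fun ε hε => by rw [inter_comm]; exact hAB ε hε, ?_⟩
  rw [Set.disjoint_left]
  rintro x ⟨a, ha, h⟩ ⟨b, hb, h'⟩
  exact lt_asymm (h b hb) (h' a ha)

/-! ### Iterated balls and chains -/

/-- The ball of radius `n` around `x` with respect to the symmetrization of `ε`. -/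
def iterBall (ε : Set (X × X)) (x : X) : ℕ → Set X
  | 0 => {x}
  | n + 1 => {y | ∃ z ∈ iterBall ε x n, (z, y) ∈ ε ∨ (y, z) ∈ ε}

theorem exists_iterBall_subset (E : CoarseStructure X) {ε : Set (X × X)} (hε : ε ∈ E.sets)
    (n : ℕ) : ∃ δ ∈ E.sets, ∀ x, iterBall ε x n ⊆ relBall δ x := by
  induction n with
  | zero =>
    refine ⟨_, E.diag_mem, fun x y hy => ?_⟩
    obtain rfl : y = x := hy
    rfl
  | succ n ih =>
    obtain ⟨δ, hδ, h⟩ := ih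
    refine ⟨_, E.comp_mem δ hδ _ (E.union_mem hε (E.inv_mem ε hε)), ?_⟩
    rintro x y ⟨z, hz, hzy⟩
    exact ⟨z, h x hz, hzy⟩

/-- An increasing sequence of sets in which each set contains the `ε`-neighbourhood of the
preceding one. -/
def IsChain (ε : Set (X × X)) (B : ℕ → Set X) : Prop :=
  Monotone B ∧ ∀ k, ∀ x ∈ B k, ∀ y, (x, y) ∈ ε ∨ (y, x) ∈ ε → y ∈ B (k + 1)

theorem IsChain.mono {ε δ : Set (X × X)} {B : ℕ → Set X} (h : IsChain δ B) (hεδ : ε ⊆ δ) :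
    IsChain ε B :=
  ⟨h.1, fun k x hx y hy => h.2 k x hx y (hy.imp (@hεδ _) (@hεδ _))⟩

theorem isChain_iterBall {ε : Set (X × X)} (hε : diagonal X ⊆ ε) (x : X) :
    IsChain ε (iterBall ε x) :=
  ⟨monotone_nat_of_le_succ fun _ z hz => ⟨z, hz, Or.inl (hε rfl)⟩, fun _ z hz _ hy => ⟨z, hz, hy⟩⟩

/-- A pair in `ε` is separated by at most one member of an `ε`-chain. -/
theorem IsChain.subsingleton {ε : Set (X × X)} {B : ℕ → Set X} (h : IsChain ε B) {x y : X}
    (hxy : (x, y) ∈ ε) : {k | ¬ (x ∈ B k ↔ y ∈ B k)}.Subsingleton := by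
  have key : ∀ k l, k < l → ¬ (x ∈ B k ↔ y ∈ B k) → ¬ (x ∈ B l ↔ y ∈ B l) → False := by
    -- Once the `k`-th member contains one of the two points, every later member contains both.
    intro k l hkl hk hl
    have hm : B k ⊆ B l := h.1 hkl.le
    have hs : B (k + 1) ⊆ B l := h.1 hkl
    by_cases hx : x ∈ B k
    · exact hl ⟨fun _ => hs (h.2 k x hx y (Or.inl hxy)), fun _ => hm hx⟩
    · by_cases hy : y ∈ B k
      · exact hl ⟨fun _ => hm hy, fun _ => hs (h.2 k y hy x (Or.inr hxy))⟩
      · exact hk (by tauto)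
  intro k hk l hl
  rcases lt_trichotomy k l with hkl | hkl | hkl
  · exact (key k l hkl hk hl).elim
  · exact hkl
  · exact (key l k hkl hl hk).elim

end CoarseStructure

/-! ### Vector ideals -/

namespace VectorIdeal

variable {V : Type u} [AddCommGroup V] [Module ℝ V] {W : Type v} [AddCommGroup W] [Module ℝ W]

theorem add_mem' (I : VectorIdeal V) {U U' : Set V} (hU : U ∈ I.sets) (hU' : U' ∈ I.sets) :
    U + U' ∈ I.sets :=
  I.mem_of_subset _ (I.add_mem _ (I.union_mem U hU U' hU')) _
    (Set.add_subset_add subset_union_left subset_union_right)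

theorem neg_mem (I : VectorIdeal V) {U : Set V} (hU : U ∈ I.sets) : -U ∈ I.sets :=
  I.mem_of_subset _ (I.smul_mem U hU 1 one_pos) _ fun v hv => ⟨-1, by simp, -v, hv, by simp⟩

theorem isBounded_iff (I : VectorIdeal V) (B : Set V) : I.toCoarse.IsBounded B ↔ B ∈ I.sets := by
  constructor
  · rintro ⟨x, ε, ⟨-, U, hU, hε⟩, hB⟩
    refine I.mem_of_subset _ (I.add_mem' (I.singleton_mem x) (I.neg_mem hU)) _ fun v hv => ?_
    have : x - v ∈ U := hε (hB hv)
    exact ⟨x, rfl, v - x, by simpa using this, by simp⟩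
  · intro hB
    refine ⟨0, {p | p.1 = p.2 ∨ p.1 - p.2 ∈ -B}, ⟨fun p hp => Or.inl hp, -B ∪ {0},
      I.union_mem _ (I.neg_mem hB) _ (I.singleton_mem 0), ?_⟩, fun v hv => Or.inr (by simpa)⟩
    rintro ⟨a, b⟩ (h | h)
    · exact Or.inr (sub_eq_zero.2 h)
    · exact Or.inl h

/-- The entourage `{(x, y) | x = y or x - y ∈ U}`. -/
def entourage (U : Set V) : Set (V × V) := {p | p.1 = p.2 ∨ p.1 - p.2 ∈ U}

theorem entourage_mem (I : VectorIdeal V) {U : Set V} (hU : U ∈ I.sets) :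
    entourage U ∈ I.toCoarse.sets := by
  refine ⟨fun p hp => Or.inl hp, U ∪ {0}, I.union_mem _ hU _ (I.singleton_mem 0), ?_⟩
  rintro ⟨a, b⟩ (h | h)
  · exact Or.inr (sub_eq_zero.2 h)
  · exact Or.inl h

/-- The preimage of a vector ideal under a linear map. -/
def comap (h : V →ₗ[ℝ] W) (J : VectorIdeal W) : VectorIdeal V where
  sets := {U | h '' U ∈ J.sets}
  union_mem U hU U' hU' := by
    show h '' (U ∪ U') ∈ J.sets
    rw [image_union]
    exact J.union_mem _ hU _ hU'
  mem_of_subset U hU U' h' := J.mem_of_subset _ hU _ (image_mono h')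
  add_mem U hU := by
    show h '' (U + U) ∈ J.sets
    rw [Set.image_add]
    exact J.add_mem _ hU
  smul_mem U hU c hc := by
    refine J.mem_of_subset _ (J.smul_mem _ hU c hc) _ ?_
    rintro _ ⟨_, ⟨r, hr, u, hu, rfl⟩, rfl⟩
    exact ⟨r, hr, h u, ⟨u, hu, rfl⟩, (map_smul h r u).symm⟩
  sUnion_eq := eq_univ_of_forall fun v => ⟨{v}, by
    show h '' {v} ∈ J.sets
    rw [image_singleton]
    exact J.singleton_mem _, rfl⟩

/-- A linear map respects differences, so only balls around `0` matter. -/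
theorem isCoarseMap_iff_forall_image_mem (I : VectorIdeal V) (J : VectorIdeal W)
    (h : V →ₗ[ℝ] W) : I.toCoarse.IsCoarseMap J.toCoarse h ↔ ∀ U ∈ I.sets, h '' U ∈ J.sets := by
  constructor
  · intro hc U hU
    obtain ⟨δ, ⟨-, U', hU', hδ⟩, H⟩ := hc _ (I.entourage_mem hU)
    refine J.mem_of_subset _ hU' _ ?_
    rintro _ ⟨u, hu, rfl⟩
    have : (h u, h 0) ∈ δ := H u ⟨0, Or.inr (by simpa using hu), rfl⟩
    simpa using hδ this
  · rintro H ε ⟨-, U, hU, hε⟩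
    refine ⟨_, J.entourage_mem (H U hU), ?_⟩
    rintro x _ ⟨y, hy, rfl⟩
    exact Or.inr ⟨x - y, hε hy, map_sub h x y⟩

/-- The bounded sets of the real line. -/
def realBounded : VectorIdeal ℝ where
  sets := {U | ∃ M : ℝ, ∀ u ∈ U, |u| ≤ M}
  union_mem := by
    rintro U ⟨M, hM⟩ U' ⟨M', hM'⟩
    refine ⟨max M M', ?_⟩
    rintro u (h | h)
    · exact (hM u h).trans (le_max_left _ _)
    · exact (hM' u h).trans (le_max_right _ _)
  mem_of_subset := by
    rintro U ⟨M, hM⟩ W hW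
    exact ⟨M, fun u hu => hM u (hW hu)⟩
  add_mem := by
    rintro U ⟨M, hM⟩
    refine ⟨M + M, ?_⟩
    rintro _ ⟨a, ha, b, hb, rfl⟩
    exact (abs_add_le a b).trans (add_le_add (hM a ha) (hM b hb))
  smul_mem := by
    rintro U ⟨M, hM⟩ c hc
    refine ⟨c * M, ?_⟩
    rintro _ ⟨r, hr, u, hu, rfl⟩
    show |r * u| ≤ _
    rw [abs_mul]
    exact mul_le_mul (abs_le.2 hr) (hM u hu) (abs_nonneg _) hc.le
  sUnion_eq := eq_univ_of_forall fun v => ⟨{v}, ⟨|v|, by rintro _ rfl; rfl⟩, rfl⟩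

/-- A vector ideal whose members are the subsets of the terms of a sequence `S` of symmetric sets
with `S 0 = {0}` and `S n + S n ⊆ S (n + 1)` is metrizable. -/
theorem isMetrizable_of_seq (I : VectorIdeal V) (S : ℕ → Set V) (hmem : ∀ n, S n ∈ I.sets)
    (hcof : ∀ U ∈ I.sets, ∃ n, U ⊆ S n) (h0 : S 0 = {0}) (hneg : ∀ n, ∀ v ∈ S n, -v ∈ S n)
    (hadd : ∀ n, S n + S n ⊆ S (n + 1)) : I.toCoarse.IsMetrizable := by
  classical
  have hz : ∀ n, (0 : V) ∈ S n := by
    intro n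
    induction n with
    | zero => rw [h0]; rfl
    | succ n ih => exact hadd n ⟨0, ih, 0, ih, add_zero 0⟩
  have hmono : Monotone S :=
    monotone_nat_of_le_succ fun n v hv => hadd n ⟨v, hv, 0, hz n, add_zero v⟩
  have hex : ∀ v, ∃ n, v ∈ S n := fun v => by
    obtain ⟨n, hn⟩ := hcof _ (I.singleton_mem v)
    exact ⟨n, hn rfl⟩
  let ν : V → ℕ := fun v => Nat.find (hex v)
  have hν : ∀ v, v ∈ S (ν v) := fun v => Nat.find_spec (hex v)
  have hle : ∀ v n, v ∈ S n → ν v ≤ n := fun v n h => Nat.find_min' (hex v) h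
  have hν0 : ∀ v, ν v = 0 → v = 0 := fun v h => by
    have := hν v
    rwa [h, h0] at this
  have hν00 : ν 0 = 0 := Nat.le_zero.1 (hle 0 0 (hz 0))
  have hνneg : ∀ v, ν (-v) ≤ ν v := fun v => hle _ _ (hneg _ _ (hν v))
  -- Here `ν (v + w) ≤ max (ν v) (ν w) + 1`, which is at most the sum when both values are positive;
  -- a zero value forces a zero vector since `S 0 = {0}`.
  have hνadd : ∀ v w, ν (v + w) ≤ ν v + ν w := by
    intro v w
    rcases Nat.eq_zero_or_pos (ν v) with hv | hv
    · rw [hν0 v hv, zero_add]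
      omega
    rcases Nat.eq_zero_or_pos (ν w) with hw | hw
    · rw [hν0 w hw, add_zero]
      omega
    refine (hle _ _ (hadd (max (ν v) (ν w)) ⟨v, hmono (le_max_left _ _) (hν v), w,
      hmono (le_max_right _ _) (hν w), rfl⟩)).trans ?_
    omega
  let m : MetricSpace V :=
    { dist := fun x y => ν (x - y)
      dist_self := fun x => by simp [hν00]
      dist_comm := fun x y => by
        have h1 := hνneg (x - y)
        have h2 := hνneg (y - x)
        rw [neg_sub] at h1 h2
        exact_mod_cast le_antisymm h2 h1
      dist_triangle := fun x y z => by
        have := hνadd (x - y) (y - z)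
        rw [sub_add_sub_cancel] at this
        exact_mod_cast this
      eq_of_dist_eq_zero := fun {x y} h => sub_eq_zero.1 (hν0 _ (by exact_mod_cast h)) }
  have hdist : ∀ x y : V, dist x y = (ν (x - y) : ℝ) := fun _ _ => rfl
  refine ⟨m, CoarseStructure.ext (Set.ext fun ε => ⟨?_, ?_⟩)⟩
  · rintro ⟨hd, U, hU, hε⟩
    obtain ⟨n, hn⟩ := hcof U hU
    refine ⟨hd, n + 1, by positivity, fun p hp => ?_⟩
    show dist p.1 p.2 < _
    rw [hdist]
    exact_mod_cast Nat.lt_succ_of_le (hle _ n (hn (hε hp)))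
  · rintro ⟨hd, r, -, hε⟩
    obtain ⟨n, hn⟩ := exists_nat_gt r
    refine ⟨hd, S n, hmem n, fun p hp => ?_⟩
    have h : dist p.1 p.2 < r := hε hp
    rw [hdist] at h
    have h' : ν (p.1 - p.2) ≤ n := by exact_mod_cast (h.trans hn).le
    exact hmono h' (hν _)

end VectorIdeal

/-! ### The least ideal containing the differences -/

section Free

variable {X : Type u}

/-- The differences of the basis vectors indexed by pairs in `ε`. -/
def diffSet (ε : Set (X × X)) : Set (X →₀ ℝ) :=
  {v | ∃ x y, (x, y) ∈ ε ∧ v = Finsupp.single x 1 - Finsupp.single y 1}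

theorem diffSet_mono {ε δ : Set (X × X)} (h : ε ⊆ δ) : diffSet ε ⊆ diffSet δ :=
  fun _ ⟨x, y, hxy, hv⟩ => ⟨x, y, h hxy, hv⟩

/-- The least vector ideal containing the sets `diffSet ε` for the entourages `ε`. -/
def freeVectorIdeal (E : CoarseStructure X) : VectorIdeal (X →₀ ℝ) where
  sets := {U | ∀ J : VectorIdeal (X →₀ ℝ), (∀ ε ∈ E.sets, diffSet ε ∈ J.sets) → U ∈ J.sets}
  union_mem _ hU _ hU' J hJ := J.union_mem _ (hU J hJ) _ (hU' J hJ)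
  mem_of_subset _ hU _ hW J hJ := J.mem_of_subset _ (hU J hJ) _ hW
  add_mem _ hU J hJ := J.add_mem _ (hU J hJ)
  smul_mem _ hU c hc J hJ := J.smul_mem _ (hU J hJ) c hc
  sUnion_eq := eq_univ_of_forall fun v => ⟨{v}, fun J _ => J.singleton_mem v, rfl⟩

theorem diffSet_mem_freeVectorIdeal (E : CoarseStructure X) {ε : Set (X × X)} (hε : ε ∈ E.sets) :
    diffSet ε ∈ (freeVectorIdeal E).sets :=
  fun _ hJ => hJ ε hε

theorem sUnion_eq_univ_of_single {S : Set (Set (X →₀ ℝ))} (h0 : {0} ∈ S)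
    (hunion : ∀ U ∈ S, ∀ U' ∈ S, U ∪ U' ∈ S) (hadd : ∀ U ∈ S, U + U ∈ S)
    (hsmul : ∀ U ∈ S, ∀ c : ℝ, 0 < c → Icc (-c) c • U ∈ S)
    (hsingle : ∀ x, ∃ U ∈ S, Finsupp.single x 1 ∈ U) : ⋃₀ S = univ := by
  refine eq_univ_of_forall fun v => ?_
  induction v using Finsupp.induction_linear with
  | zero => exact ⟨_, h0, rfl⟩
  | add f g hf hg =>
    obtain ⟨U, hU, hfU⟩ := hf
    obtain ⟨U', hU', hgU⟩ := hg
    exact ⟨_, hadd _ (hunion U hU U' hU'), f, Or.inl hfU, g, Or.inr hgU, rfl⟩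
  | single x b =>
    obtain ⟨U, hU, hx⟩ := hsingle x
    refine ⟨_, hsmul U hU (|b| + 1) (by positivity), b, ?_, _, hx, by simp⟩
    exact abs_le.1 (by linarith)

/-! ### Crossing numbers and the embedding of `X` -/

/-- The linear functional `v ↦ ∑ v x (1_B x - 1_B x₀)`. -/
noncomputable def chainFunctional (x₀ : X) (B : Set X) : (X →₀ ℝ) →ₗ[ℝ] ℝ :=
  Finsupp.linearCombination ℝ fun x => B.indicator 1 x - B.indicator 1 x₀

theorem chainFunctional_single (x₀ : X) (B : Set X) (x : X) :
    chainFunctional x₀ B (Finsupp.single x 1) = B.indicator 1 x - B.indicator 1 x₀ := by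
  simp [chainFunctional]

/-- Every `ε`-chain has at most `n` members whose functional does not vanish at `v`. -/
def CrossingBound (x₀ : X) (ε : Set (X × X)) (n : ℕ) (v : X →₀ ℝ) : Prop :=
  ∀ B : ℕ → Set X, CoarseStructure.IsChain ε B →
    {k | chainFunctional x₀ (B k) v ≠ 0}.encard ≤ n

theorem CrossingBound.mono {x₀ : X} {ε δ : Set (X × X)} {n m : ℕ} {v : X →₀ ℝ}
    (h : CrossingBound x₀ ε n v) (hεδ : ε ⊆ δ) (hnm : n ≤ m) : CrossingBound x₀ δ m v :=
  fun B hB => (h B (hB.mono hεδ)).trans (by exact_mod_cast hnm)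

theorem CrossingBound.add {x₀ : X} {ε : Set (X × X)} {n m : ℕ} {v w : X →₀ ℝ}
    (hv : CrossingBound x₀ ε n v) (hw : CrossingBound x₀ ε m w) :
    CrossingBound x₀ ε (n + m) (v + w) := by
  intro B hB
  have hsub : {k | chainFunctional x₀ (B k) (v + w) ≠ 0} ⊆
      {k | chainFunctional x₀ (B k) v ≠ 0} ∪ {k | chainFunctional x₀ (B k) w ≠ 0} := by
    intro k hk
    by_contra hcon
    simp only [mem_union, mem_ofPred_eq, not_or, not_not] at hcon
    exact hk (by rw [map_add, hcon.1, hcon.2, add_zero])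
  refine (encard_le_encard hsub).trans ((encard_union_le _ _).trans ?_)
  push_cast
  exact add_le_add (hv B hB) (hw B hB)

/-- Only nonvanishing is counted, not size, so scalars cost nothing. -/
theorem CrossingBound.smul {x₀ : X} {ε : Set (X × X)} {n : ℕ} {v : X →₀ ℝ}
    (hv : CrossingBound x₀ ε n v) (c : ℝ) : CrossingBound x₀ ε n (c • v) := by
  intro B hB
  have hsub : {k | chainFunctional x₀ (B k) (c • v) ≠ 0} ⊆
      {k | chainFunctional x₀ (B k) v ≠ 0} := by
    intro k hk hk'
    exact hk (by rw [map_smul, hk', smul_zero])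
  exact (encard_le_encard hsub).trans (hv B hB)

theorem crossingBound_zero (x₀ : X) (ε : Set (X × X)) (n : ℕ) : CrossingBound x₀ ε n 0 := by
  intro B _
  simp

theorem crossingBound_sub (x₀ : X) {ε : Set (X × X)} {x y : X} (hxy : (x, y) ∈ ε) :
    CrossingBound x₀ ε 1 (Finsupp.single x 1 - Finsupp.single y 1) := by
  intro B hB
  have : {k | chainFunctional x₀ (B k) (Finsupp.single x 1 - Finsupp.single y 1) ≠ 0} ⊆
      {k | ¬ (x ∈ B k ↔ y ∈ B k)} := by
    intro k hk hiff
    refine hk ?_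
    rw [map_sub, chainFunctional_single, chainFunctional_single]
    by_cases hx : x ∈ B k
    · simp [hx, hiff.1 hx]
    · simp [hx, mt hiff.2 hx]
  exact_mod_cast encard_le_one_iff_subsingleton.2 ((hB.subsingleton hxy).anti this)

/-- The functionals vanish at `x₀`, so `x` counts like `x - x₀`. Without this normalization `x`
would be counted by every ball around `x`, and `crossingIdeal` would not cover the space. -/
theorem crossingBound_single {x₀ : X} {ε : Set (X × X)} {x : X} (hx : (x, x₀) ∈ ε) :
    CrossingBound x₀ ε 1 (Finsupp.single x 1) := by
  intro B hB
  convert crossingBound_sub x₀ hx B hB using 5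
  rw [map_sub, chainFunctional_single x₀ _ x₀, sub_self, sub_zero]

/-- The vector ideal of sets with uniformly bounded crossing numbers. -/
def crossingIdeal (E : CoarseStructure X) (x₀ : X) : VectorIdeal (X →₀ ℝ) where
  sets := {U | ∃ ε ∈ E.sets, ∃ n, ∀ u ∈ U, CrossingBound x₀ ε n u}
  union_mem := by
    rintro U ⟨ε, hε, n, h⟩ U' ⟨δ, hδ, m, h'⟩
    refine ⟨_, E.union_mem hε hδ, max n m, ?_⟩
    rintro u (hu | hu)
    · exact (h u hu).mono subset_union_left (le_max_left _ _)
    · exact (h' u hu).mono subset_union_right (le_max_right _ _)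
  mem_of_subset := by
    rintro U ⟨ε, hε, n, h⟩ W hW
    exact ⟨ε, hε, n, fun u hu => h u (hW hu)⟩
  add_mem := by
    rintro U ⟨ε, hε, n, h⟩
    refine ⟨ε, hε, n + n, ?_⟩
    rintro _ ⟨a, ha, b, hb, rfl⟩
    exact (h a ha).add (h b hb)
  smul_mem := by
    rintro U ⟨ε, hε, n, h⟩ c _
    refine ⟨ε, hε, n, ?_⟩
    rintro _ ⟨r, -, u, hu, rfl⟩
    exact (h u hu).smul r
  sUnion_eq := by
    refine eq_univ_of_forall fun v => ?_
    suffices h : ∃ ε ∈ E.sets, ∃ n, CrossingBound x₀ ε n v by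
      obtain ⟨ε, hε, n, h⟩ := h
      exact ⟨{v}, ⟨ε, hε, n, by rintro _ rfl; exact h⟩, rfl⟩
    induction v using Finsupp.induction_linear with
    | zero => exact ⟨_, E.diag_mem, 0, crossingBound_zero _ _ _⟩
    | add f g hf hg =>
      obtain ⟨ε, hε, n, hf⟩ := hf
      obtain ⟨δ, hδ, m, hg⟩ := hg
      exact ⟨_, E.union_mem hε hδ, n + m,
        (hf.mono subset_union_left le_rfl).add (hg.mono subset_union_right le_rfl)⟩
    | single x b =>
      obtain ⟨ε, hε, hx⟩ := E.connected x x₀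
      refine ⟨ε, hε, 1, ?_⟩
      simpa using (crossingBound_single hx).smul b

theorem freeVectorIdeal_subset_crossingIdeal (E : CoarseStructure X) (x₀ : X) :
    (freeVectorIdeal E).sets ⊆ (crossingIdeal E x₀).sets := by
  refine fun U hU => hU _ fun ε hε => ⟨ε, hε, 1, ?_⟩
  rintro _ ⟨x, y, hxy, rfl⟩
  exact crossingBound_sub x₀ hxy

/-- If `y` misses the ball of radius `n`, then the `n + 1` balls of radius `0, …, n` all separate it
from the centre `x`. -/
theorem CrossingBound.mem_iterBall {x₀ x y : X} {ε : Set (X × X)} (hε : diagonal X ⊆ ε) {n : ℕ}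
    (h : CrossingBound x₀ ε n (Finsupp.single x 1 - Finsupp.single y 1)) :
    y ∈ CoarseStructure.iterBall ε x n := by
  by_contra hy
  have hB := CoarseStructure.isChain_iterBall hε x
  have hsub : ((Finset.range (n + 1) : Finset ℕ) : Set ℕ) ⊆
      {k | chainFunctional x₀ (CoarseStructure.iterBall ε x k)
        (Finsupp.single x 1 - Finsupp.single y 1) ≠ 0} := by
    intro k hk
    have hk : k ≤ n := by simpa [Nat.lt_succ_iff] using hk
    have hxk : x ∈ CoarseStructure.iterBall ε x k := hB.1 (Nat.zero_le k) rfl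
    have hyk : y ∉ CoarseStructure.iterBall ε x k := fun h => hy (hB.1 hk h)
    simp [map_sub, chainFunctional_single, hxk, hyk]
  have := (encard_le_encard hsub).trans (h _ hB)
  rw [encard_coe_eq_coe_finsetCard, Finset.card_range] at this
  have : n + 1 ≤ n := by exact_mod_cast this
  omega

theorem isSubballean_freeVectorIdeal (E : CoarseStructure X) :
    E.IsSubballean (freeVectorIdeal E).toCoarse (fun x => Finsupp.single x (1 : ℝ)) := by
  have hinj : Function.Injective fun x : X => Finsupp.single x (1 : ℝ) :=
    Finsupp.single_left_injective one_ne_zero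
  refine ⟨hinj, fun ε => ⟨fun hε => ?_, ?_⟩⟩
  · refine ⟨diagonal _ ∪ Prod.map (Finsupp.single · 1) (Finsupp.single · 1) '' ε,
      ⟨subset_union_left, diffSet ε ∪ {0}, VectorIdeal.union_mem _ _
        (diffSet_mem_freeVectorIdeal E hε) _ (VectorIdeal.singleton_mem _ 0), ?_⟩, ?_⟩
    · rintro ⟨a, b⟩ (h | ⟨⟨x, y⟩, hxy, h⟩)
      · exact Or.inr (sub_eq_zero.2 h)
      · obtain ⟨rfl, rfl⟩ := Prod.mk.inj h
        exact Or.inl ⟨x, y, hxy, rfl⟩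
    · exact eq_preimage_diagonal_union_image hinj (E.diag_subset ε hε)
  · rintro ⟨ε', ⟨hd, U, hU, hε'⟩, rfl⟩
    rcases isEmpty_or_nonempty X with hX | ⟨⟨x₀⟩⟩
    · exact E.mem_of_subset _ E.diag_mem _ (fun p => hX.elim p.1) fun p => hX.elim p.1
    · obtain ⟨δ, hδ, n, H⟩ := freeVectorIdeal_subset_crossingIdeal E x₀ hU
      obtain ⟨δ', hδ', hball⟩ := E.exists_iterBall_subset hδ n
      refine E.mem_of_subset δ' hδ' _ ?_ ?_
      · rintro ⟨x, y⟩ h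
        obtain rfl : x = y := h
        exact hd rfl
      · rintro ⟨x, y⟩ h
        exact hball x ((H _ (hε' h)).mem_iterBall (E.diag_subset δ hδ))

/-! ### Universal property and uniqueness -/

theorem isFreeVectorIdeal_freeVectorIdeal (E : CoarseStructure X) :
    IsFreeVectorIdeal E (freeVectorIdeal E) where
  subballean := isSubballean_freeVectorIdeal E
  lift W _ _ J f hf := by
    have hlin : ∀ x, Finsupp.linearCombination ℝ f (Finsupp.single x 1) = f x := by simp
    refine ⟨Finsupp.linearCombination ℝ f, ⟨?_, hlin⟩, ?_⟩
    · rw [VectorIdeal.isCoarseMap_iff_forall_image_mem]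
      refine fun U hU => hU (J.comap (Finsupp.linearCombination ℝ f)) fun ε hε => ?_
      obtain ⟨δ, ⟨-, U', hU', hδ⟩, H⟩ := hf ε hε
      refine J.mem_of_subset _ hU' _ ?_
      rintro _ ⟨_, ⟨x, y, hxy, rfl⟩, rfl⟩
      rw [map_sub, hlin, hlin]
      exact hδ (H x ⟨y, hxy, rfl⟩)
    · rintro h ⟨-, hh⟩
      refine Finsupp.lhom_ext' fun x => LinearMap.ext_ring ?_
      simp [hh]

theorem IsFreeVectorIdeal.sets_subset {E : CoarseStructure X} {I J : VectorIdeal (X →₀ ℝ)}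
    (hI : IsFreeVectorIdeal E I) (hJ : IsFreeVectorIdeal E J) : I.sets ⊆ J.sets := by
  have hc : E.IsCoarseMap J.toCoarse fun x => Finsupp.single x (1 : ℝ) := by
    intro ε hε
    obtain ⟨ε', hε', rfl⟩ := (hJ.subballean.2 ε).1 hε
    refine ⟨ε', hε', ?_⟩
    rintro x _ ⟨y, hy, rfl⟩
    exact hy
  obtain ⟨h, ⟨hcoarse, hh⟩, -⟩ := hI.lift _ J _ hc
  have hid : h = LinearMap.id := by
    refine Finsupp.lhom_ext' fun x => LinearMap.ext_ring ?_
    simp [hh]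
  subst hid
  intro U hU
  simpa using (VectorIdeal.isCoarseMap_iff_forall_image_mem I J _).1 hcoarse U hU

theorem IsFreeVectorIdeal.eq_freeVectorIdeal {E : CoarseStructure X} {I : VectorIdeal (X →₀ ℝ)}
    (hI : IsFreeVectorIdeal E I) : I = freeVectorIdeal E :=
  VectorIdeal.ext ((hI.sets_subset (isFreeVectorIdeal_freeVectorIdeal E)).antisymm
    ((isFreeVectorIdeal_freeVectorIdeal E).sets_subset hI))

/-! ### From a countable base to a metric -/

/-- An increasing sequence of sets exhausting the free vector ideal of a ballean with base `ε`;
the vector `g` is one of the basis vectors, if there are any. -/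
def levelSet (ε : ℕ → Set (X × X)) (g : X →₀ ℝ) : ℕ → Set (X →₀ ℝ)
  | 0 => {0}
  | n + 1 => Icc (-(n + 1 : ℝ)) (n + 1) •
      ((levelSet ε g n + levelSet ε g n) ∪ (diffSet (ε n) ∪ {g}))

section levelSet

variable (ε : ℕ → Set (X × X)) (g : X →₀ ℝ)

theorem subset_levelSet_succ (n : ℕ) :
    (levelSet ε g n + levelSet ε g n) ∪ (diffSet (ε n) ∪ {g}) ⊆ levelSet ε g (n + 1) := by
  intro v hv
  refine ⟨1, ⟨?_, ?_⟩, v, hv, one_smul ℝ v⟩ <;> linarith [n.cast_nonneg (α := ℝ)]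

theorem zero_mem_levelSet (n : ℕ) : 0 ∈ levelSet ε g n := by
  induction n with
  | zero => rfl
  | succ n ih => exact subset_levelSet_succ ε g n (Or.inl ⟨0, ih, 0, ih, add_zero 0⟩)

theorem levelSet_mono : Monotone (levelSet ε g) :=
  monotone_nat_of_le_succ fun n v hv =>
    subset_levelSet_succ ε g n (Or.inl ⟨v, hv, 0, zero_mem_levelSet ε g n, add_zero v⟩)

theorem neg_mem_levelSet (n : ℕ) (v : X →₀ ℝ) (hv : v ∈ levelSet ε g n) :
    -v ∈ levelSet ε g n := by
  cases n with
  | zero =>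
    obtain rfl : v = 0 := hv
    exact neg_zero
  | succ n =>
    obtain ⟨r, hr, u, hu, rfl⟩ := hv
    exact ⟨-r, ⟨by linarith [hr.2], by linarith [hr.1]⟩, u, hu, neg_smul r u⟩

theorem smul_levelSet_subset {n k : ℕ} (hnk : n ≤ k) {c : ℝ} (hck : c ≤ k) :
    Icc (-c) c • levelSet ε g n ⊆ levelSet ε g (k + 1) := by
  rintro _ ⟨r, hr, u, hu, rfl⟩
  exact ⟨r, ⟨by linarith [hr.1], by linarith [hr.2]⟩, u, Or.inl ⟨u, levelSet_mono ε g hnk hu, 0,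
    zero_mem_levelSet ε g k, add_zero u⟩, rfl⟩

theorem levelSet_mem {E : CoarseStructure X} (hε : ∀ n, ε n ∈ E.sets) (n : ℕ) :
    levelSet ε g n ∈ (freeVectorIdeal E).sets := by
  induction n with
  | zero => exact VectorIdeal.singleton_mem _ 0
  | succ n ih =>
    refine VectorIdeal.smul_mem _ _ ?_ _ (by positivity)
    exact VectorIdeal.union_mem _ _ (VectorIdeal.add_mem _ _ ih) _ (VectorIdeal.union_mem _ _
      (diffSet_mem_freeVectorIdeal E (hε n)) _ (VectorIdeal.singleton_mem _ g))

/-- By minimality: the subsets of level sets form a vector ideal containing all `diffSet δ`. -/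
theorem exists_subset_levelSet {E : CoarseStructure X} (hcof : ∀ δ ∈ E.sets, ∃ n, δ ⊆ ε n)
    (hg : ∀ _ : X, ∃ y : X, g = Finsupp.single y 1) {U : Set (X →₀ ℝ)}
    (hU : U ∈ (freeVectorIdeal E).sets) : ∃ n, U ⊆ levelSet ε g n := by
  have hdiff : ∀ δ ∈ E.sets, ∃ n, diffSet δ ⊆ levelSet ε g n := fun δ hδ => by
    obtain ⟨n, hn⟩ := hcof δ hδ
    exact ⟨n + 1, (diffSet_mono hn).trans (Subset.trans (fun v hv => Or.inr (Or.inl hv))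
      (subset_levelSet_succ ε g n))⟩
  have hunion : ∀ U ∈ {U | ∃ n, U ⊆ levelSet ε g n}, ∀ U' ∈ {U | ∃ n, U ⊆ levelSet ε g n},
      U ∪ U' ∈ {U | ∃ n, U ⊆ levelSet ε g n} := by
    rintro U ⟨n, hn⟩ U' ⟨m, hm⟩
    exact ⟨max n m, union_subset (hn.trans (levelSet_mono ε g (le_max_left _ _)))
      (hm.trans (levelSet_mono ε g (le_max_right _ _)))⟩
  have hadd : ∀ U ∈ {U | ∃ n, U ⊆ levelSet ε g n}, U + U ∈ {U | ∃ n, U ⊆ levelSet ε g n} := by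
    rintro U ⟨n, hn⟩
    exact ⟨n + 1, (Set.add_subset_add hn hn).trans
      (subset_union_left.trans (subset_levelSet_succ ε g n))⟩
  have hsmul : ∀ U ∈ {U | ∃ n, U ⊆ levelSet ε g n}, ∀ c : ℝ, 0 < c →
      Icc (-c) c • U ∈ {U | ∃ n, U ⊆ levelSet ε g n} := by
    rintro U ⟨n, hn⟩ c -
    obtain ⟨k, hk⟩ := exists_nat_ge c
    exact ⟨max n k + 1, (Set.smul_subset_smul_left hn).trans (smul_levelSet_subset ε g
      (le_max_left _ _) (hk.trans (by exact_mod_cast le_max_right n k)))⟩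
  refine hU
    { sets := {U | ∃ n, U ⊆ levelSet ε g n}
      union_mem := hunion
      mem_of_subset := fun _ ⟨n, hn⟩ _ hW => ⟨n, hW.trans hn⟩
      add_mem := hadd
      smul_mem := hsmul
      sUnion_eq := ?_ } hdiff
  refine sUnion_eq_univ_of_single ⟨0, subset_rfl⟩ hunion hadd hsmul fun x => ?_
  -- Differences span only vectors of coordinate sum `0`; adding `g = y` recovers `x` as `(x - y) +
  -- y`.
  obtain ⟨y, rfl⟩ := hg x
  obtain ⟨δ, hδ, hxy⟩ := E.connected x y
  exact ⟨_, hadd _ (hunion _ (hdiff δ hδ) {Finsupp.single y 1}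
    ⟨1, fun v hv => subset_levelSet_succ ε _ 0 (Or.inr (Or.inr hv))⟩),
    _, Or.inl ⟨x, y, hxy, rfl⟩, Finsupp.single y 1, Or.inr rfl, sub_add_cancel _ _⟩

end levelSet

theorem CoarseStructure.HasCountableBase.isMetrizable_freeVectorIdeal {E : CoarseStructure X}
    (h : E.HasCountableBase) : (freeVectorIdeal E).toCoarse.IsMetrizable := by
  obtain ⟨ε, hε, hcof⟩ := h
  obtain ⟨g, hg⟩ : ∃ g : X →₀ ℝ, ∀ _ : X, ∃ y : X, g = Finsupp.single y 1 := by
    rcases isEmpty_or_nonempty X with hX | ⟨⟨x₀⟩⟩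
    · exact ⟨0, hX.elim⟩
    · exact ⟨Finsupp.single x₀ 1, fun _ => ⟨x₀, rfl⟩⟩
  exact VectorIdeal.isMetrizable_of_seq _ (levelSet ε g) (levelSet_mem ε g hε)
    (fun U hU => exists_subset_levelSet ε g hcof hg hU) rfl (neg_mem_levelSet ε g)
    fun n => subset_union_left.trans (subset_levelSet_succ ε g n)

/-! ### From normality to a countable base -/

/-- The sum of the coordinates. -/
noncomputable def coordSum (X : Type u) : (X →₀ ℝ) →ₗ[ℝ] ℝ :=
  Finsupp.linearCombination ℝ fun _ => (1 : ℝ)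

theorem coordSum_single (x : X) (c : ℝ) : coordSum X (Finsupp.single x c) = c := by
  simp [coordSum]

theorem coordSum_of_mem_diffSet {ε : Set (X × X)} {v : X →₀ ℝ} (hv : v ∈ diffSet ε) :
    coordSum X v = 0 := by
  obtain ⟨x, y, -, rfl⟩ := hv
  rw [map_sub, coordSum_single, coordSum_single, sub_self]

theorem exists_abs_coordSum_le {E : CoarseStructure X} {U : Set (X →₀ ℝ)}
    (hU : U ∈ (freeVectorIdeal E).sets) : ∃ M : ℝ, ∀ u ∈ U, |coordSum X u| ≤ M := by
  obtain ⟨M, hM⟩ := hU (VectorIdeal.realBounded.comap (coordSum X)) fun ε _ => ⟨0, by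
    rintro _ ⟨v, hv, rfl⟩
    rw [coordSum_of_mem_diffSet hv, abs_zero]⟩
  exact ⟨M, fun u hu => hM _ ⟨u, hu, rfl⟩⟩

/-- The coordinate sum of a point close to both sets is within `M` of `n` and of `0`, so `n ≤ 2 * M`
and the point lies near a bounded piece of the ray. -/
theorem asymptoticallyDisjoint_ray_ker (E : CoarseStructure X) (x₀ : X) :
    (freeVectorIdeal E).toCoarse.AsymptoticallyDisjoint
      (range fun n : ℕ => Finsupp.single x₀ (n : ℝ)) {v | coordSum X v = 0} := by
  rintro ε ⟨-, U, hU, hε⟩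
  rw [VectorIdeal.isBounded_iff]
  obtain ⟨M, hM⟩ := exists_abs_coordSum_le hU
  have hM1 : 0 < |2 * M| + 1 := by positivity
  refine VectorIdeal.mem_of_subset _ _ (VectorIdeal.add_mem' _ (VectorIdeal.smul_mem _ _
    (VectorIdeal.singleton_mem _ (Finsupp.single x₀ 1)) (|2 * M| + 1) hM1)
    (VectorIdeal.neg_mem _ hU)) _ ?_
  rintro v ⟨hA, hB⟩
  simp only [relBallSet, relBall, mem_iUnion, mem_ofPred_eq, exists_prop, exists_range_iff]
    at hA hB
  obtain ⟨n, hn⟩ := hA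
  obtain ⟨b, hb, hbv⟩ := hB
  have hn : Finsupp.single x₀ (n : ℝ) - v ∈ U := hε hn
  have h1 := abs_le.1 (hM _ hn)
  have h2 := abs_le.1 (hM _ (hε hbv))
  simp only [map_sub, coordSum_single, hb] at h1 h2
  have hle : (n : ℝ) ≤ |2 * M| + 1 := by linarith [le_abs_self (2 * M)]
  refine ⟨Finsupp.single x₀ (n : ℝ), ⟨n, ⟨by linarith [n.cast_nonneg (α := ℝ)], hle⟩, _, rfl,
    by simp⟩, v - Finsupp.single x₀ (n : ℝ), by simpa using hn, by simp⟩

theorem hasCountableBase_of_isNormal {E : CoarseStructure X}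
    (h : (freeVectorIdeal E).toCoarse.IsNormal) : E.HasCountableBase := by
  rcases isEmpty_or_nonempty X with hX | ⟨⟨x₀⟩⟩
  · exact ⟨fun _ => diagonal X, fun _ => E.diag_mem, fun δ _ => ⟨0, fun p => hX.elim p.1⟩⟩
  obtain ⟨P, Q, hP, hQ, hPQ⟩ := h _ _ (asymptoticallyDisjoint_ray_ker E x₀)
  let C : ℕ → Set (X →₀ ℝ) := fun n =>
    {c | coordSum X c = 0 ∧ Finsupp.single x₀ (n : ℝ) + c ∉ Q}
  -- The translate `n x₀ + ker` lies in a single entourage neighbourhood of the kernel, so its part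
  -- outside `Q` is bounded.
  have hC : ∀ n, C n ∈ (freeVectorIdeal E).sets := by
    intro n
    have hb := hQ _ (VectorIdeal.entourage_mem _
      (VectorIdeal.singleton_mem (freeVectorIdeal E) (-Finsupp.single x₀ (n : ℝ))))
    rw [VectorIdeal.isBounded_iff] at hb
    refine VectorIdeal.mem_of_subset _ _ (VectorIdeal.add_mem' _
      (VectorIdeal.singleton_mem _ (-Finsupp.single x₀ (n : ℝ))) hb) _ ?_
    rintro c ⟨hc, hcQ⟩
    refine ⟨_, rfl, Finsupp.single x₀ (n : ℝ) + c, ⟨?_, hcQ⟩, by simp⟩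
    simp only [relBallSet, relBall, mem_iUnion, mem_ofPred_eq, exists_prop]
    exact ⟨c, hc, Or.inr (by simp)⟩
  -- The part of `ℕ x₀ + D` outside `P` is bounded, hence has bounded coordinate sums. For large `n`
  -- the whole of `n x₀ + D` lies in `P`, so it avoids `Q`.
  have hcof : ∀ D ∈ (freeVectorIdeal E).sets, (∀ v ∈ D, coordSum X v = 0) → ∃ n, D ⊆ C n := by
    intro D hD hD0
    have hb := hP _ (VectorIdeal.entourage_mem _ (VectorIdeal.neg_mem _ hD))
    rw [VectorIdeal.isBounded_iff] at hb
    obtain ⟨M, hM⟩ := exists_abs_coordSum_le hb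
    obtain ⟨n, hn⟩ := exists_nat_gt M
    refine ⟨n, fun v hv => ⟨hD0 v hv, fun hvQ => ?_⟩⟩
    have hvP : Finsupp.single x₀ (n : ℝ) + v ∉ P := fun h => Set.disjoint_left.1 hPQ h hvQ
    have := hM (Finsupp.single x₀ (n : ℝ) + v) ⟨by
      simp only [relBallSet, relBall, mem_iUnion, mem_ofPred_eq, exists_prop, exists_range_iff]
      exact ⟨n, Or.inr (by simpa using hv)⟩, hvP⟩
    rw [map_add, coordSum_single, hD0 v hv, add_zero] at this
    linarith [le_abs_self (n : ℝ)]
  refine ⟨fun n => {p | (Finsupp.single p.1 1, Finsupp.single p.2 1) ∈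
    VectorIdeal.entourage (C n)}, fun n => ?_, fun δ hδ => ?_⟩
  · exact ((isSubballean_freeVectorIdeal E).2 _).2 ⟨_, VectorIdeal.entourage_mem _ (hC n), rfl⟩
  · obtain ⟨n, hn⟩ := hcof _ (diffSet_mem_freeVectorIdeal E hδ)
      fun v hv => coordSum_of_mem_diffSet hv
    exact ⟨n, fun p hp => Or.inr (hn ⟨p.1, p.2, hp, rfl⟩)⟩

end Free

/-- Every ballean has exactly one free vector ballean, and this one is normal if and only if it
is metrizable, if and only if the given ballean is metrizable. -/
theorem theorem3 {X : Type*} (E : CoarseStructure X) :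
    (∃! I : VectorIdeal (X →₀ ℝ), IsFreeVectorIdeal E I) ∧
      ∀ I : VectorIdeal (X →₀ ℝ), IsFreeVectorIdeal E I →
        (I.toCoarse.IsNormal ↔ I.toCoarse.IsMetrizable) ∧
        (I.toCoarse.IsMetrizable ↔ E.IsMetrizable) := by
  refine ⟨⟨_, isFreeVectorIdeal_freeVectorIdeal E, fun I hI => hI.eq_freeVectorIdeal⟩, ?_⟩
  intro I hI
  obtain rfl := hI.eq_freeVectorIdeal
  exact ⟨⟨fun h => (hasCountableBase_of_isNormal h).isMetrizable_freeVectorIdeal,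
      CoarseStructure.isNormal_of_isMetrizable⟩,
    fun h => h.of_isSubballean (isSubballean_freeVectorIdeal E),
    fun h => h.hasCountableBase.isMetrizable_freeVectorIdeal⟩
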